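/- Let $A=\mathbb{C}^{d_A}$ and $B=\mathbb{C}^{d_B}$ be finite-dimensional Hilbert spaces, let $\mathcal{U}:\mathrm{L}(A)\to\mathrm{L}(B)$ be a linear map (for instance, with $A=B$, the unitary channel $\mathcal{U}(\rho)=U\rho U^\dagger$), let $\{\mathcal{E}_i\}_i$ be a fixed finite family of linear maps $\mathrm{L}(A)\to\mathrm{L}(B)$ (the decomposition set), and let $\gamma_{\mathrm{budget}}\in\mathbb{R}$. For a linear map $\mathcal{G}:\mathrm{L}(A)\to\mathrm{L}(B)$, let $\|\mathcal{G}\|_\diamond=\sup\{\|(\mathcal{G}\otimes\mathrm{id}_{\mathrm{L}(A)})(X)\|_1: X\in \mathrm{L}(A\otimes A),\ \|X\|_1\le 1\}$ be its diamond norm, where $\|\cdot\|_1$ is the trace norm, and let $\Lambda_{\mathcal{G}}=\sum_{p,q}\mathcal{G}(|p\rangle\langle q|)\otimes|p\rangle\langle q|\in\mathrm{L}(B\otimes A)$ be its unnormalised Choi matrix. Write $\|\cdot\|_\infty$ for the spectral norm, $\mathrm{tr}_B$ for the partial trace $\mathrm{L}(B\otimes A)\to\mathrm{L}(A)$, and $^*$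 for the adjoint. Consider the budget-constrained approximate quasiprobability decomposition problem $$\text{(P)}\qquad \min_{a_i\in\mathbb{R}}\ \Big\|\mathcal{U}-\sum_i a_i\mathcal{E}_i\Big\|_\diamond\quad\text{s.t.}\quad \sum_i|a_i|\le\gamma_{\mathrm{budget}}$$ and the program $$\text{(S)}\qquad \min_{a_i\in\mathbb{R},\;Y_0,Y_1\in\mathrm{L}(B\otimes A)}\ \tfrac12\|\mathrm{tr}_B[Y_0]\|_\infty+\tfrac12\|\mathrm{tr}_B[Y_1]\|_\infty$$ $$\text{s.t.}\quad \begin{pmatrix}Y_0&\sum_i a_i\Lambda_{\mathcal{E}_i}-\Lambda_{\mathcal{U}}\\ \sum_i a_i\Lambda_{\mathcal{E}_i}^*-\Lambda_{\mathcal{U}}^*&Y_1\end{pmatrix}\ge0,\quad \sum_i|a_i|\le\gamma_{\mathrm{budget}},\quad Y_0\ge0,\ Y_1\ge0 .$$ Then: 1. (S) is a semidefinite program, in the sense that its epigraph, i.e. the set of all $(a,Y_0,Y_1,t)$ with $(a,Y_0,Y_1)$ feasible and objective value at most $t$, is described by a linear matrix inequality with finitely many real auxiliary variables. 2. If $\gamma_{\mathrm{budget}}\ge0$,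 then the minima in (P) and in (S) are both attained, and they are equal. 3. For every fixed $a$ with $\sum_i|a_i|\le\gamma_{\mathrm{budget}}$, the minimum of the objective of (S) over all $(Y_0,Y_1)$ for which $(a,Y_0,Y_1)$ is feasible is attained and equals $\|\mathcal{U}-\sum_i a_i\mathcal{E}_i\|_\diamond$. 4. A coefficient vector $a$ is a minimiser of (P) if and only if there are $Y_0,Y_1$ such that $(a,Y_0,Y_1)$ is a minimiser of (S). -/

import Mathlib

/-! Systems `A`, `B` are finite-dimensional Hilbert spaces `ℂ^a`, `ℂ^b` for finite index types
`a`, `b`; `L(A)` is `Matrix a a ℂ`, and `L(B ⊗ A)` is `Matrix (b × a) (b × a) ℂ`. -/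

namespace ApproxQPD

noncomputable section

open scoped ComplexOrder

variable {a b r ι : Type*} [Fintype a] [DecidableEq a] [Fintype b] [DecidableEq b]
  [Fintype r] [DecidableEq r] [Fintype ι]

/-- Trace norm `‖X‖₁ = tr √(X* X)`: the sum of the singular values of `X`. -/
def traceNorm (X : Matrix r r ℂ) : ℝ :=
  ∑ i, √((Matrix.isHermitian_conjTranspose_mul_self X).eigenvalues i)

/-- Spectral norm `‖X‖_∞`: the operator norm of `X` on Euclidean space. -/
def specNorm (X : Matrix r r ℂ) : ℝ :=
  ‖Matrix.toEuclideanCLM (n := r) (𝕜 := ℂ) X‖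

/-- `(Φ ⊗ id_{L(R)})(X)`: apply `Φ` to each `A`-block of `X ∈ L(A ⊗ R)`. -/
def tensorId (Φ : Matrix a a ℂ →ₗ[ℂ] Matrix b b ℂ) (X : Matrix (a × r) (a × r) ℂ) :
    Matrix (b × r) (b × r) ℂ :=
  Matrix.of fun i j => Φ (Matrix.of fun p q => X (p, i.2) (q, j.2)) i.1 j.1

/-- Diamond norm `‖Φ‖_⋄ = sup { ‖(Φ ⊗ id_{L(A)})(X)‖₁ : X ∈ L(A ⊗ A), ‖X‖₁ ≤ 1 }`.
The set contains `0`, and it is bounded because the spaces are finite-dimensional. -/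
def diamondNorm (Φ : Matrix a a ℂ →ₗ[ℂ] Matrix b b ℂ) : ℝ :=
  sSup {t : ℝ | ∃ X : Matrix (a × a) (a × a) ℂ,
    traceNorm X ≤ 1 ∧ t = traceNorm (tensorId Φ X)}

/-- The (unnormalised) Choi matrix `Λ_Φ = ∑_{p,q} Φ(E_{pq}) ⊗ E_{pq} ∈ L(B ⊗ A)`. -/
def choi (Φ : Matrix a a ℂ →ₗ[ℂ] Matrix b b ℂ) : Matrix (b × a) (b × a) ℂ :=
  Matrix.of fun i j => Φ (Matrix.single i.2 j.2 1) i.1 j.1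

/-- Partial trace `tr_B : L(B ⊗ A) → L(A)`. -/
def partialTraceB (Y : Matrix (b × a) (b × a) ℂ) : Matrix a a ℂ :=
  Matrix.of fun p q => ∑ i, Y (i, p) (i, q)

/-- The `γ`-factor `∑ |a_i|` of real coefficients. -/
def gammaFactor (c : ι → ℝ) : ℝ := ∑ i, |c i|

/-- Feasible set of the budget-constrained approximate QPD problem. -/
def budgetFeasible (ι : Type*) [Fintype ι] (γ : ℝ) : Set (ι → ℝ) := {c | gammaFactor c ≤ γ}

/-- Objective of the budget-constrained approximate QPD problem: `‖𝒰 - ∑ a_i ℰ_i‖_⋄`. -/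
def budgetObjective (U : Matrix a a ℂ →ₗ[ℂ] Matrix b b ℂ)
    (E : ι → Matrix a a ℂ →ₗ[ℂ] Matrix b b ℂ) (c : ι → ℝ) : ℝ :=
  diamondNorm (U - ∑ i, (c i : ℂ) • E i)

/-- The variables `(a_i, Y₀, Y₁)` of the semidefinite program. -/
abbrev SDPVar (a b ι : Type*) : Type _ :=
  (ι → ℝ) × Matrix (b × a) (b × a) ℂ × Matrix (b × a) (b × a) ℂ

/-- Feasible set of the semidefinite program. -/
def sdpFeasible (U : Matrix a a ℂ →ₗ[ℂ] Matrix b b ℂ)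
    (E : ι → Matrix a a ℂ →ₗ[ℂ] Matrix b b ℂ) (γ : ℝ) : Set (SDPVar a b ι) :=
  {z | (Matrix.fromBlocks
          z.2.1 (∑ i, (z.1 i : ℂ) • choi (E i) - choi U)
          (∑ i, (z.1 i : ℂ) • (choi (E i)).conjTranspose - (choi U).conjTranspose)
          z.2.2).PosSemidef ∧
       gammaFactor z.1 ≤ γ ∧ z.2.1.PosSemidef ∧ z.2.2.PosSemidef}

/-- Objective of the semidefinite program: `½ ‖tr_B Y₀‖_∞ + ½ ‖tr_B Y₁‖_∞`. -/
def sdpObjective (z : SDPVar a b ι) : ℝ :=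
  1 / 2 * specNorm (partialTraceB z.2.1) + 1 / 2 * specNorm (partialTraceB z.2.2)

/-- A set in a real vector space is semidefinite representable if it is described, with finitely
many real auxiliary variables, by one linear matrix inequality `C + L (x, u) ≥ 0`. (Requiring
`C + L (x, u)` to be positive semidefinite includes requiring it to be Hermitian, which is a
system of real linear equations in `(x, u)`.) -/
def SemidefiniteRepresentable {V : Type*} [AddCommGroup V] [Module ℝ V] (S : Set V) : Prop :=
  ∃ (N m : ℕ) (C : Matrix (Fin m) (Fin m) ℂ)
    (L : V × (Fin N → ℝ) →ₗ[ℝ] Matrix (Fin m) (Fin m) ℂ),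
    ∀ x : V, x ∈ S ↔ ∃ u : Fin N → ℝ, (C + L (x, u)).PosSemidef

/-- Minimising `f` over `S` is a semidefinite program: its epigraph is semidefinite
representable, so that it amounts to minimising the linear function `t` subject to a linear
matrix inequality. -/
def IsSemidefiniteProgram {V : Type*} [AddCommGroup V] [Module ℝ V] (S : Set V) (f : V → ℝ) :
    Prop :=
  SemidefiniteRepresentable {y : V × ℝ | y.1 ∈ S ∧ f y.1 ≤ y.2}

end

end ApproxQPD

/-! The trace norm of `T` is the least value of `½ tr P + ½ tr Q` over positive semidefinite block
matrices `(P, T; T*, Q)`, as the singular value decomposition of `T` shows. Conjugating a block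
matrix `(Y₀, Λ_Φ; Λ_Φ*, Y₁)` by `1 ⊗ M` and `1 ⊗ N` turns its off-diagonal block into
`(Φ ⊗ id)(|vec M⟩⟨vec N|)`, and unit vectors `vec M`, `vec N` generate the trace norm unit ball;
hence `‖Φ‖_⋄ ≤ ½ ‖tr_B Y₀‖_∞ + ½ ‖tr_B Y₁‖_∞`.

Conversely, the right hand side is the supremum over pairs of states `(σ, τ)` of
`½ Re tr (tr_B Y₀ σ) + ½ Re tr (tr_B Y₁ τ)`. For fixed invertible `σ = M* M` and `τ = N* N`, an
optimal block matrix for `(Φ ⊗ id)(|vec M⟩⟨vec N|)`, conjugated back by `1 ⊗ M⁻¹` and `1 ⊗ N⁻¹`,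
gives a feasible `(Y₀, Y₁)` at which this is at most `‖Φ‖_⋄`; Sion's minimax theorem then provides
one that works for all states, up to an arbitrarily small error. The traces of `Y₀` and `Y₁` are
bounded by the objective, so its sublevel sets are compact and the minimum is attained.

Applied to `Φ = 𝒰 - ∑ a_i ℰ_i`, this exhibits the semidefinite program as a minimisation in stages
of the diamond norm. It is semidefinite because `‖N‖_∞ ≤ s` means `s • 1 - N ≥ 0` for `N ≥ 0`, and
`∑ |a_i| ≤ γ` means that `-u ≤ a ≤ u` for some `u` with `∑ u_i ≤ γ`. -/

namespace ApproxQPD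

noncomputable section

open Matrix Kronecker
open scoped ComplexOrder

theorem posSemidef_fromBlocks_vecMulVec {r : Type*} [Finite r] (u v : r → ℂ) :
    (fromBlocks (vecMulVec u (star u)) (vecMulVec u (star v)) (vecMulVec u (star v))ᴴ
      (vecMulVec v (star v))).PosSemidef := by
  convert posSemidef_vecMulVec_self_star (Sum.elim u v) using 1
  ext (i | i) (j | j) <;> simp [vecMulVec_apply]

section TraceNorm

variable {r : Type*} [Fintype r] [DecidableEq r]

theorem exists_orthonormalBasis_forall_eq_smul {𝕜 F : Type*} [RCLike 𝕜] [NormedAddCommGroup F]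
    [InnerProductSpace 𝕜 F] [FiniteDimensional 𝕜 F] (hr : Module.finrank 𝕜 F = Fintype.card r)
    {g : r → F} {s : r → ℝ} (hg : ∀ i j, inner 𝕜 (g i) (g j) = if i = j then (s i : 𝕜) ^ 2 else 0) :
    ∃ e : OrthonormalBasis r 𝕜 F, ∀ j, g j = (s j : 𝕜) • e j := by
  have orthonormal_g :
      Orthonormal 𝕜 ({i | s i ≠ 0}.domRestrict fun i => (s i : 𝕜)⁻¹ • g i) := by
    rw [orthonormal_iff_ite]
    rintro ⟨i, hi⟩ ⟨j, hj⟩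
    have hi' : (s i : 𝕜) ≠ 0 := RCLike.ofReal_ne_zero.2 hi
    simp only [Set.domRestrict_apply, inner_smul_left, inner_smul_right, hg, Subtype.mk.injEq,
      map_inv₀, RCLike.conj_ofReal]
    split_ifs with hij
    · subst hij
      field_simp
    · simp
  obtain ⟨e, he⟩ := orthonormal_g.exists_orthonormalBasis_extension_of_card_eq hr
  refine ⟨e, fun j => ?_⟩
  by_cases hj : s j = 0
  · have : inner 𝕜 (g j) (g j) = 0 := by rw [hg, if_pos rfl, hj, RCLike.ofReal_zero, sq, mul_zero]
    rw [inner_self_eq_zero.1 this, hj, RCLike.ofReal_zero, zero_smul]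
  · rw [he j hj, smul_inv_smul₀ (RCLike.ofReal_ne_zero.2 hj)]

theorem exists_mem_unitaryGroup_eq_mul_diagonal {𝕜 : Type*} [RCLike 𝕜] {G : Matrix r r 𝕜}
    {s : r → ℝ} (hG : Gᴴ * G = diagonal fun i => (s i : 𝕜) ^ 2) :
    ∃ W ∈ unitaryGroup r 𝕜, G = W * diagonal fun i => (s i : 𝕜) := by
  let g : r → EuclideanSpace 𝕜 r := fun j => WithLp.toLp 2 fun i => G i j
  have inner_g (i j : r) : inner 𝕜 (g i) (g j) = if i = j then (s i : 𝕜) ^ 2 else 0 :=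
    calc inner 𝕜 (g i) (g j) = (Gᴴ * G) i j := by
          rw [EuclideanSpace.inner_eq_star_dotProduct, dotProduct_comm]; rfl
      _ = _ := by rw [hG, diagonal_apply]
  obtain ⟨e, he⟩ := exists_orthonormalBasis_forall_eq_smul finrank_euclideanSpace inner_g
  refine ⟨(EuclideanSpace.basisFun r 𝕜).toBasis.toMatrix e,
    (EuclideanSpace.basisFun r 𝕜).toMatrix_orthonormalBasis_mem_unitary e, ?_⟩
  ext i j
  rw [mul_diagonal, mul_comm]
  exact congrArg (fun x : EuclideanSpace 𝕜 r => x i) (he j)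

theorem exists_singularValueDecomposition (T : Matrix r r ℂ) :
    ∃ W ∈ unitaryGroup r ℂ, ∃ V ∈ unitaryGroup r ℂ, ∃ s : r → ℝ, (∀ i, 0 ≤ s i) ∧
      ∑ i, s i = traceNorm T ∧ T = W * diagonal (fun i => (s i : ℂ)) * Vᴴ := by
  set hT := isHermitian_conjTranspose_mul_self T
  set V : Matrix r r ℂ := (hT.eigenvectorUnitary : Matrix r r ℂ)
  have hVmem : V ∈ unitaryGroup r ℂ := hT.eigenvectorUnitary.2
  have gram : (T * V)ᴴ * (T * V) = diagonal fun i => (√(hT.eigenvalues i) : ℂ) ^ 2 :=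
    calc (T * V)ᴴ * (T * V) = Vᴴ * (Tᴴ * T) * V := by
          simp only [conjTranspose_mul, Matrix.mul_assoc]
      _ = diagonal fun i => (hT.eigenvalues i : ℂ) := by
          have h := hT.conjStarAlgAut_star_eigenvectorUnitary
          simp only [Unitary.conjStarAlgAut_apply, Unitary.coe_star, star_star] at h
          exact h
      _ = _ := by
          simp only [← Complex.ofReal_pow,
            Real.sq_sqrt (eigenvalues_conjTranspose_mul_self_nonneg T _)]
  obtain ⟨W, hW, hTV : T * V = W * diagonal fun i => ((√(hT.eigenvalues i) : ℝ) : ℂ)⟩ :=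
    exists_mem_unitaryGroup_eq_mul_diagonal gram
  refine ⟨W, hW, V, hVmem, _, fun _ => Real.sqrt_nonneg _, rfl, ?_⟩
  rw [← hTV, Matrix.mul_assoc, ← star_eq_conjTranspose, Unitary.mul_star_self_of_mem hVmem,
    Matrix.mul_one]

theorem trace_diagonal_ofReal (s : r → ℝ) :
    (diagonal fun i => (s i : ℂ)).trace = ((∑ i, s i : ℝ) : ℂ) := by
  rw [trace_diagonal, Complex.ofReal_sum]

theorem trace_mul_mul_conjTranspose_of_mem_unitaryGroup {W : Matrix r r ℂ}
    (hW : W ∈ unitaryGroup r ℂ) (D : Matrix r r ℂ) : (W * D * Wᴴ).trace = D.trace := by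
  rw [trace_mul_cycle, ← star_eq_conjTranspose, Unitary.star_mul_self_of_mem hW, Matrix.one_mul]

theorem exists_posSemidef_fromBlocks_trace_eq_traceNorm (T : Matrix r r ℂ) :
    ∃ P Q : Matrix r r ℂ, (fromBlocks P T Tᴴ Q).PosSemidef ∧
      P.trace = traceNorm T ∧ Q.trace = traceNorm T := by
  obtain ⟨W, hW, V, hV, s, hs, hsum, hT⟩ := exists_singularValueDecomposition T
  have hD : (diagonal fun i => (s i : ℂ)).PosSemidef :=
    PosSemidef.diagonal fun i => by simpa using hs i
  refine ⟨W * (diagonal fun i => (s i : ℂ)) * Wᴴ, V * (diagonal fun i => (s i : ℂ)) * Vᴴ, ?_, ?_,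
    ?_⟩
  · convert hD.mul_mul_conjTranspose_same (fromRows W V) using 1
    rw [conjTranspose_fromRows_eq_fromCols_conjTranspose, fromRows_mul, fromRows_mul_fromCols, ← hT,
      hT, conjTranspose_mul, conjTranspose_mul, conjTranspose_conjTranspose, hD.isHermitian.eq,
      ← Matrix.mul_assoc V]
  · rw [trace_mul_mul_conjTranspose_of_mem_unitaryGroup hW, trace_diagonal_ofReal, hsum]
  · rw [trace_mul_mul_conjTranspose_of_mem_unitaryGroup hV, trace_diagonal_ofReal, hsum]

theorem traceNorm_le_of_posSemidef_fromBlocks {P T Q : Matrix r r ℂ}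
    (h : (fromBlocks P T Tᴴ Q).PosSemidef) :
    traceNorm T ≤ 1 / 2 * P.trace.re + 1 / 2 * Q.trace.re := by
  obtain ⟨W, hW, V, hV, s, -, hsum, hT⟩ := exists_singularValueDecomposition T
  have trace_corner : (Wᴴ * T * V).trace = traceNorm T := by
    have : Wᴴ * T * V = Wᴴ * W * (diagonal fun i => (s i : ℂ)) * (Vᴴ * V) := by
      simp only [hT, Matrix.mul_assoc]
    rw [this, ← star_eq_conjTranspose, ← star_eq_conjTranspose, Unitary.star_mul_self_of_mem hW,
      Unitary.star_mul_self_of_mem hV, Matrix.one_mul, Matrix.mul_one, trace_diagonal_ofReal, hsum]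
  have trace_corner' : (Vᴴ * Tᴴ * W).trace = traceNorm T := by
    have : Vᴴ * Tᴴ * W = (Wᴴ * T * V)ᴴ := by
      simp only [conjTranspose_mul, conjTranspose_conjTranspose, Matrix.mul_assoc]
    rw [this, trace_conjTranspose, trace_corner, Complex.star_def, Complex.conj_ofReal]
  have trace_P : (Wᴴ * P * W).trace = P.trace := by
    simpa [star_eq_conjTranspose] using
      trace_mul_mul_conjTranspose_of_mem_unitaryGroup (Unitary.star_mem hW) P
  have trace_Q : (Vᴴ * Q * V).trace = Q.trace := by
    simpa [star_eq_conjTranspose] using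
      trace_mul_mul_conjTranspose_of_mem_unitaryGroup (Unitary.star_mem hV) Q
  have h_nonneg := (h.conjTranspose_mul_mul_same (fromRows W (-V))).trace_nonneg
  rw [conjTranspose_fromRows_eq_fromCols_conjTranspose, fromCols_mul_fromBlocks,
    fromCols_mul_fromRows] at h_nonneg
  simp only [conjTranspose_neg, Matrix.neg_mul, Matrix.mul_neg, Matrix.add_mul, trace_add,
    trace_neg, trace_corner, trace_corner', trace_P, trace_Q] at h_nonneg
  have h_re := (Complex.le_def.1 h_nonneg).1
  simp only [Complex.zero_re, Complex.add_re, Complex.neg_re, Complex.ofReal_re] at h_re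
  linarith

theorem exists_eq_sum_smul_vecMulVec (T : Matrix r r ℂ) :
    ∃ (s : r → ℝ) (u v : r → r → ℂ), (∀ k, 0 ≤ s k) ∧ ∑ k, s k = traceNorm T ∧
      (∀ k, star (u k) ⬝ᵥ u k = 1) ∧ (∀ k, star (v k) ⬝ᵥ v k = 1) ∧
      T = ∑ k, (s k : ℂ) • vecMulVec (u k) (star (v k)) := by
  obtain ⟨W, hW, V, hV, s, hs, hsum, hT⟩ := exists_singularValueDecomposition T
  have unit_col {W : Matrix r r ℂ} (hW : W ∈ unitaryGroup r ℂ) (k : r) :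
      star (W.col k) ⬝ᵥ W.col k = 1 := by
    rw [← one_apply_eq k, ← Unitary.star_mul_self_of_mem hW]
    rfl
  refine ⟨s, W.col, V.col, hs, hsum, unit_col hW, unit_col hV, ?_⟩
  ext i j
  rw [hT, mul_apply]
  simp only [mul_diagonal, conjTranspose_apply, Matrix.sum_apply, Matrix.smul_apply,
    vecMulVec_apply, col_apply, Pi.star_apply, smul_eq_mul]
  exact Finset.sum_congr rfl fun k _ => by ring

theorem traceNorm_vecMulVec_le (u v : r → ℂ) :
    traceNorm (vecMulVec u (star v)) ≤
      1 / 2 * (star u ⬝ᵥ u).re + 1 / 2 * (star v ⬝ᵥ v).re := by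
  have h := traceNorm_le_of_posSemidef_fromBlocks (posSemidef_fromBlocks_vecMulVec u v)
  rwa [trace_vecMulVec, trace_vecMulVec, dotProduct_comm, dotProduct_comm v] at h

theorem traceNorm_sum_smul_le {κ : Type*} [Fintype κ] {t : κ → ℝ} (ht : ∀ k, 0 ≤ t k)
    (T : κ → Matrix r r ℂ) :
    traceNorm (∑ k, (t k : ℂ) • T k) ≤ ∑ k, t k * traceNorm (T k) := by
  choose P Q hPQ hP hQ using fun k => exists_posSemidef_fromBlocks_trace_eq_traceNorm (T k)
  have h : (fromBlocks (∑ k, (t k : ℂ) • P k) (∑ k, (t k : ℂ) • T k) (∑ k, (t k : ℂ) • T k)ᴴ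
      (∑ k, (t k : ℂ) • Q k)).PosSemidef := by
    convert posSemidef_sum Finset.univ fun k _ =>
      (hPQ k).smul (Complex.zero_le_real.2 (ht k)) using 1
    ext (i | i) (j | j) <;> simp [Matrix.sum_apply]
  have trace_eq {R : κ → Matrix r r ℂ} (hR : ∀ k, (R k).trace = traceNorm (T k)) :
      (∑ k, (t k : ℂ) • R k).trace.re = ∑ k, t k * traceNorm (T k) := by
    simp [trace_sum, hR]
  have := traceNorm_le_of_posSemidef_fromBlocks h
  rw [trace_eq hP, trace_eq hQ] at this
  linarith

end TraceNorm

section PosSemidef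

theorem isClosed_posSemidef {n : Type*} [Finite n] :
    IsClosed {M : Matrix n n ℂ | M.PosSemidef} := by
  have := Fintype.ofFinite n
  simp_rw [posSemidef_iff_dotProduct_mulVec, Set.ofPred_and, Set.ofPred_forall]
  exact (isClosed_eq (by fun_prop) continuous_id).inter
    (isClosed_iInter fun x => isClosed_le continuous_const (by fun_prop))

variable {n : Type*} [Fintype n]

/-- The density matrices, that is, the quantum states. -/
def densityMatrices (n : Type*) [Fintype n] : Set (Matrix n n ℂ) :=
  {σ | σ.PosSemidef ∧ σ.trace = 1}

theorem convex_densityMatrices : Convex ℝ (densityMatrices n) := by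
  rintro σ ⟨hσ, hσ_trace⟩ τ ⟨hτ, hτ_trace⟩ s t hs ht hst
  refine ⟨(hσ.smul hs).add (hτ.smul ht), ?_⟩
  rw [trace_add, trace_smul, trace_smul, hσ_trace, hτ_trace, ← add_smul, hst, one_smul]

section SpecNorm

variable [DecidableEq n]

theorem continuous_specNorm : Continuous (specNorm : Matrix n n ℂ → ℝ) :=
  (toEuclideanCLM (n := n) (𝕜 := ℂ)).toAlgEquiv.toLinearMap.continuous_of_finiteDimensional.norm

theorem specNorm_nonneg (N : Matrix n n ℂ) : 0 ≤ specNorm N := norm_nonneg _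

theorem specNorm_smul_add_smul_le {s t : ℝ} (hs : 0 ≤ s) (ht : 0 ≤ t) (M N : Matrix n n ℂ) :
    specNorm (s • M + t • N) ≤ s * specNorm M + t * specNorm N := by
  simp only [specNorm, map_add, ← Complex.coe_smul, map_smul]
  exact (norm_add_le _ _).trans_eq (by simp [norm_smul, abs_of_nonneg, hs, ht])

open scoped Matrix.Norms.L2Operator MatrixOrder in
theorem specNorm_le_iff {N : Matrix n n ℂ} (hN : N.PosSemidef) {s : ℝ} (hs : 0 ≤ s) :
    specNorm N ≤ s ↔ ((s : ℂ) • (1 : Matrix n n ℂ) - N).PosSemidef := by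
  rw [specNorm, l2_opNorm_toEuclideanCLM, CStarAlgebra.norm_le_iff_le_algebraMap N hs hN.nonneg,
    le_iff, Algebra.algebraMap_eq_smul_one]
  rfl

theorem re_trace_mul_mul_conjTranspose_le {r : Type*} [Fintype r] {N : Matrix n n ℂ}
    (hN : N.PosSemidef) (M : Matrix r n ℂ) :
    (M * N * Mᴴ).trace.re ≤ specNorm N * (M * Mᴴ).trace.re := by
  have h := ((specNorm_le_iff hN (specNorm_nonneg N)).1 le_rfl).mul_mul_conjTranspose_same M
  simpa [Matrix.mul_sub, Matrix.sub_mul] using (Complex.le_def.1 h.trace_nonneg).1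

open scoped Matrix.Norms.L2Operator MatrixOrder in
theorem exists_eigenvalues_eq_specNorm [Nonempty n] {N : Matrix n n ℂ} (hN : N.PosSemidef) :
    ∃ i, hN.isHermitian.eigenvalues i = specNorm N := by
  have h := CStarAlgebra.norm_mem_spectrum_of_nonneg hN.nonneg
  rwa [hN.isHermitian.spectrum_real_eq_range_eigenvalues, ← l2_opNorm_toEuclideanCLM] at h

theorem specNorm_le_re_trace {N : Matrix n n ℂ} (hN : N.PosSemidef) :
    specNorm N ≤ N.trace.re := by
  cases isEmpty_or_nonempty n
  · simp [Subsingleton.elim N 0, specNorm]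
  · obtain ⟨i, hi⟩ := exists_eigenvalues_eq_specNorm hN
    rw [← hi, hN.isHermitian.trace_eq_sum_eigenvalues, Complex.re_sum]
    exact Finset.single_le_sum (fun j _ => hN.eigenvalues_nonneg j) (Finset.mem_univ i)

theorem exists_mem_densityMatrices_re_trace_eq_specNorm [Nonempty n] {N : Matrix n n ℂ}
    (hN : N.PosSemidef) : ∃ σ ∈ densityMatrices n, (N * σ).trace.re = specNorm N := by
  obtain ⟨i, hi⟩ := exists_eigenvalues_eq_specNorm hN
  set x : n → ℂ := ⇑(hN.isHermitian.eigenvectorBasis i)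
  have unit_x : x ⬝ᵥ star x = 1 := by
    have := hN.isHermitian.eigenvectorBasis.norm_eq_one i
    rw [← inner_self_eq_one_of_norm_eq_one (𝕜 := ℂ) this, EuclideanSpace.inner_eq_star_dotProduct]
  refine ⟨vecMulVec x (star x), ⟨posSemidef_vecMulVec_self_star x, ?_⟩, ?_⟩
  · rw [trace_vecMulVec, unit_x]
  · rw [mul_vecMulVec, hN.isHermitian.mulVec_eigenvectorBasis, trace_vecMulVec, smul_dotProduct,
      unit_x, hi, Complex.real_smul, mul_one, Complex.ofReal_re]

end SpecNorm

theorem densityMatrices_nonempty [Nonempty n] : (densityMatrices n).Nonempty := by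
  classical
  have ⟨σ, hσ, _⟩ := exists_mem_densityMatrices_re_trace_eq_specNorm (PosSemidef.zero (n := n))
  exact ⟨σ, hσ⟩

open scoped Matrix.Norms.L2Operator in
theorem isCompact_posSemidef_trace_le (C : ℝ) :
    IsCompact {M : Matrix n n ℂ | M.PosSemidef ∧ M.trace.re ≤ C} := by
  classical
  have : ProperSpace (Matrix n n ℂ) := FiniteDimensional.proper ℝ _
  refine Metric.isCompact_of_isClosed_isBounded (isClosed_posSemidef.inter
    (isClosed_le (Complex.continuous_re.comp continuous_id.matrix_trace) continuous_const)) ?_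
  refine (Metric.isBounded_closedBall (x := (0 : Matrix n n ℂ)) (r := C)).subset ?_
  rintro M ⟨hM, hC⟩
  rw [mem_closedBall_zero_iff, ← l2_opNorm_toEuclideanCLM]
  exact (specNorm_le_re_trace hM).trans hC

theorem isCompact_densityMatrices : IsCompact (densityMatrices n) := by
  refine (isCompact_posSemidef_trace_le 1).of_isClosed_subset (isClosed_posSemidef.inter
    (isClosed_eq (by fun_prop) continuous_const)) ?_
  rintro σ ⟨hσ, hσ_trace⟩
  exact ⟨hσ, by rw [hσ_trace, Complex.one_re]⟩

end PosSemidef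

theorem posSemidef_fromBlocks_mul {m n : Type*} [Finite m] [Fintype n] {P T Q : Matrix n n ℂ}
    (h : (fromBlocks P T Tᴴ Q).PosSemidef) (K L : Matrix m n ℂ) :
    (fromBlocks (K * P * Kᴴ) (K * T * Lᴴ) (K * T * Lᴴ)ᴴ (L * Q * Lᴴ)).PosSemidef := by
  have := Fintype.ofFinite m
  simpa [fromBlocks_conjTranspose, fromBlocks_multiply, conjTranspose_mul, Matrix.mul_assoc] using
    h.mul_mul_conjTranspose_same (fromBlocks K 0 0 L)

theorem posSemidef_fromBlocks_neg_iff {n : Type*} [Finite n] {P T Q : Matrix n n ℂ} :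
    (fromBlocks P (-T) (-T)ᴴ Q).PosSemidef ↔ (fromBlocks P T Tᴴ Q).PosSemidef := by
  classical
  have := Fintype.ofFinite n
  have neg_block {T : Matrix n n ℂ} (h : (fromBlocks P T Tᴴ Q).PosSemidef) :
      (fromBlocks P (-T) (-T)ᴴ Q).PosSemidef := by
    simpa using posSemidef_fromBlocks_mul h (1 : Matrix n n ℂ) (-1)
  exact ⟨fun h => by simpa only [neg_neg] using neg_block h, neg_block⟩

section PartialTrace

variable {a b r : Type*} [Fintype b]

theorem partialTraceB_eq_sum_submatrix (Y : Matrix (b × a) (b × a) ℂ) :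
    partialTraceB Y = ∑ i, Y.submatrix (Prod.mk i) (Prod.mk i) := by
  ext p q
  simp [partialTraceB, Matrix.sum_apply]

theorem posSemidef_partialTraceB {Y : Matrix (b × a) (b × a) ℂ} (hY : Y.PosSemidef) :
    (partialTraceB Y).PosSemidef := by
  rw [partialTraceB_eq_sum_submatrix]
  exact posSemidef_sum _ fun i _ => hY.submatrix _

theorem continuous_partialTraceB :
    Continuous (partialTraceB : Matrix (b × a) (b × a) ℂ → Matrix a a ℂ) :=
  continuous_matrix fun _ _ => continuous_finsetSum _ fun _ _ => continuous_id.matrix_elem _ _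

theorem partialTraceB_add (Y Z : Matrix (b × a) (b × a) ℂ) :
    partialTraceB (Y + Z) = partialTraceB Y + partialTraceB Z := by
  ext p q
  exact Finset.sum_add_distrib

theorem partialTraceB_smul (t : ℝ) (Y : Matrix (b × a) (b × a) ℂ) :
    partialTraceB (t • Y) = t • partialTraceB Y := by
  ext p q
  simp only [partialTraceB, of_apply, Matrix.smul_apply, Finset.smul_sum]

variable [Fintype a]

theorem trace_partialTraceB (Y : Matrix (b × a) (b × a) ℂ) :
    (partialTraceB Y).trace = Y.trace := by
  simp only [trace, diag_apply, partialTraceB, of_apply, Fintype.sum_prod_type_right]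

variable [DecidableEq b]

theorem one_kronecker_mul_mul_conjTranspose_apply (M N : Matrix r a ℂ)
    (Y : Matrix (b × a) (b × a) ℂ) (i j : b × r) :
    (((1 : Matrix b b ℂ) ⊗ₖ M) * Y * ((1 : Matrix b b ℂ) ⊗ₖ N)ᴴ) i j =
      (M * Y.submatrix (Prod.mk i.1) (Prod.mk j.1) * Nᴴ) i.2 j.2 := by
  simp [mul_apply, Fintype.sum_prod_type, one_apply, apply_ite star]

theorem trace_one_kronecker_mul_mul_conjTranspose [Fintype r] (M : Matrix r a ℂ)
    (Y : Matrix (b × a) (b × a) ℂ) :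
    (((1 : Matrix b b ℂ) ⊗ₖ M) * Y * ((1 : Matrix b b ℂ) ⊗ₖ M)ᴴ).trace =
      (M * partialTraceB Y * Mᴴ).trace := by
  rw [partialTraceB_eq_sum_submatrix, Matrix.mul_sum, Matrix.sum_mul, trace_sum, trace,
    Fintype.sum_prod_type]
  exact Finset.sum_congr rfl fun i _ => Finset.sum_congr rfl fun k _ =>
    one_kronecker_mul_mul_conjTranspose_apply M M Y (i, k) (i, k)

end PartialTrace

section TensorId

variable {a b r : Type*}

theorem tensorId_sum_smul {κ : Type*} [Fintype κ] (Φ : Matrix a a ℂ →ₗ[ℂ] Matrix b b ℂ)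
    (s : κ → ℂ) (X : κ → Matrix (a × r) (a × r) ℂ) :
    tensorId Φ (∑ k, s k • X k) = ∑ k, s k • tensorId Φ (X k) := by
  ext i j
  have h : (of fun p q => (∑ k, s k • X k) (p, i.2) (q, j.2)) =
      ∑ k, s k • of fun p q => X k (p, i.2) (q, j.2) := by
    ext p q
    simp [Matrix.sum_apply]
  rw [tensorId, of_apply, h, map_sum]
  simp only [map_smul, Matrix.sum_apply, Matrix.smul_apply, tensorId, of_apply]

variable [Fintype a] [DecidableEq a] [Fintype b] [DecidableEq b]

theorem tensorId_vecMulVec_vec (Φ : Matrix a a ℂ →ₗ[ℂ] Matrix b b ℂ) (M N : Matrix r a ℂ) :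
    tensorId Φ (vecMulVec (vec M) (star (vec N))) =
      ((1 : Matrix b b ℂ) ⊗ₖ M) * choi Φ * ((1 : Matrix b b ℂ) ⊗ₖ N)ᴴ := by
  ext i j
  have h : (of fun p q => vecMulVec (vec M) (star (vec N)) (p, i.2) (q, j.2)) =
      ∑ q, ∑ p, (M i.2 p * star (N j.2 q)) • single p q (1 : ℂ) := by
    rw [matrix_eq_sum_single (of _), Finset.sum_comm]
    simp [vecMulVec_apply, smul_single]
  rw [one_kronecker_mul_mul_conjTranspose_apply, tensorId, of_apply, h]
  simp only [map_sum, map_smul, Matrix.sum_apply, Matrix.smul_apply, mul_apply, Finset.sum_mul,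
    submatrix_apply, choi, of_apply, conjTranspose_apply, smul_eq_mul, mul_right_comm]

variable [Fintype r] [DecidableEq r]

theorem traceNorm_tensorId_le_traceNorm_mul {Φ : Matrix a a ℂ →ₗ[ℂ] Matrix b b ℂ} {C : ℝ}
    (hC : ∀ u v : a × r → ℂ, star u ⬝ᵥ u = 1 → star v ⬝ᵥ v = 1 →
      traceNorm (tensorId Φ (vecMulVec u (star v))) ≤ C) (X : Matrix (a × r) (a × r) ℂ) :
    traceNorm (tensorId Φ X) ≤ traceNorm X * C := by
  obtain ⟨s, u, v, hs, hsum, hu, hv, hX⟩ := exists_eq_sum_smul_vecMulVec X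
  calc traceNorm (tensorId Φ X)
      = traceNorm (∑ k, (s k : ℂ) • tensorId Φ (vecMulVec (u k) (star (v k)))) := by
        rw [← tensorId_sum_smul, ← hX]
    _ ≤ ∑ k, s k * traceNorm (tensorId Φ (vecMulVec (u k) (star (v k)))) :=
        traceNorm_sum_smul_le hs _
    _ ≤ ∑ k, s k * C :=
        Finset.sum_le_sum fun k _ => mul_le_mul_of_nonneg_left (hC _ _ (hu k) (hv k)) (hs k)
    _ = traceNorm X * C := by rw [← Finset.sum_mul, hsum]

end TensorId

section WeakDuality

/-- The pairs `(Y₀, Y₁)` that are feasible in the semidefinite program dual to the one for the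
diamond norm of `Φ`. Positivity of `Y₀` and of `Y₁` is implied by that of the block matrix. -/
def dualFeasible {a b : Type*} [DecidableEq a] (Φ : Matrix a a ℂ →ₗ[ℂ] Matrix b b ℂ) :
    Set (Matrix (b × a) (b × a) ℂ × Matrix (b × a) (b × a) ℂ) :=
  {Y | (fromBlocks Y.1 (choi Φ) (choi Φ)ᴴ Y.2).PosSemidef}

/-- The objective `½ ‖tr_B Y₀‖_∞ + ½ ‖tr_B Y₁‖_∞` of the dual program of the diamond norm. -/
def dualObjective {a b : Type*} [Fintype a] [DecidableEq a] [Fintype b]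
    (Y : Matrix (b × a) (b × a) ℂ × Matrix (b × a) (b × a) ℂ) : ℝ :=
  1 / 2 * specNorm (partialTraceB Y.1) + 1 / 2 * specNorm (partialTraceB Y.2)

section

variable {a b : Type*} [DecidableEq a] {Φ : Matrix a a ℂ →ₗ[ℂ] Matrix b b ℂ}
  {Y : Matrix (b × a) (b × a) ℂ × Matrix (b × a) (b × a) ℂ}

theorem posSemidef_fst_of_mem_dualFeasible (hY : Y ∈ dualFeasible Φ) : Y.1.PosSemidef :=
  PosSemidef.submatrix hY Sum.inl

theorem posSemidef_snd_of_mem_dualFeasible (hY : Y ∈ dualFeasible Φ) : Y.2.PosSemidef :=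
  PosSemidef.submatrix hY Sum.inr

theorem dualFeasible_nonempty [Finite a] [Finite b] (Φ : Matrix a a ℂ →ₗ[ℂ] Matrix b b ℂ) :
    (dualFeasible Φ).Nonempty := by
  classical
  have := Fintype.ofFinite a
  have := Fintype.ofFinite b
  have ⟨P, Q, hPQ, _⟩ := exists_posSemidef_fromBlocks_trace_eq_traceNorm (choi Φ)
  exact ⟨(P, Q), hPQ⟩

theorem dualObjective_nonneg [Fintype a] [Fintype b]
    (Y : Matrix (b × a) (b × a) ℂ × Matrix (b × a) (b × a) ℂ) : 0 ≤ dualObjective Y := by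
  have := specNorm_nonneg (partialTraceB Y.1)
  have := specNorm_nonneg (partialTraceB Y.2)
  rw [dualObjective]
  positivity

theorem dualObjective_smul_add_smul_le [Fintype a] [Fintype b] {s t : ℝ} (hs : 0 ≤ s)
    (ht : 0 ≤ t) (Y Z : Matrix (b × a) (b × a) ℂ × Matrix (b × a) (b × a) ℂ) :
    dualObjective (s • Y + t • Z) ≤ s * dualObjective Y + t * dualObjective Z := by
  have h₀ := specNorm_smul_add_smul_le hs ht (partialTraceB Y.1) (partialTraceB Z.1)
  have h₁ := specNorm_smul_add_smul_le hs ht (partialTraceB Y.2) (partialTraceB Z.2)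
  simp only [dualObjective, Prod.fst_add, Prod.snd_add, Prod.smul_fst, Prod.smul_snd,
    partialTraceB_add, partialTraceB_smul]
  linarith

end

variable {a b : Type*} [Fintype a] [DecidableEq a] [Fintype b] [DecidableEq b]
  {Φ : Matrix a a ℂ →ₗ[ℂ] Matrix b b ℂ}
  {Y : Matrix (b × a) (b × a) ℂ × Matrix (b × a) (b × a) ℂ}

theorem re_trace_one_kronecker_vec_le {r : Type*} [Fintype r] {N : Matrix (b × a) (b × a) ℂ}
    (hN : N.PosSemidef) {M : Matrix r a ℂ} (hM : star (vec M) ⬝ᵥ vec M = 1) :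
    (((1 : Matrix b b ℂ) ⊗ₖ M) * N * ((1 : Matrix b b ℂ) ⊗ₖ M)ᴴ).trace.re ≤
      specNorm (partialTraceB N) := by
  have h := re_trace_mul_mul_conjTranspose_le (posSemidef_partialTraceB hN) M
  rwa [trace_mul_comm M, ← star_vec_dotProduct_vec, hM, Complex.one_re, mul_one,
    ← trace_one_kronecker_mul_mul_conjTranspose] at h

theorem traceNorm_tensorId_vecMulVec_le {r : Type*} [Fintype r] [DecidableEq r]
    (hY : Y ∈ dualFeasible Φ) {u v : a × r → ℂ} (hu : star u ⬝ᵥ u = 1) (hv : star v ⬝ᵥ v = 1) :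
    traceNorm (tensorId Φ (vecMulVec u (star v))) ≤ dualObjective Y := by
  obtain ⟨M, rfl⟩ := vec_bijective.2 u
  obtain ⟨N, rfl⟩ := vec_bijective.2 v
  rw [tensorId_vecMulVec_vec]
  refine (traceNorm_le_of_posSemidef_fromBlocks (posSemidef_fromBlocks_mul hY _ _)).trans ?_
  rw [dualObjective]
  gcongr
  · exact re_trace_one_kronecker_vec_le (posSemidef_fst_of_mem_dualFeasible hY) hu
  · exact re_trace_one_kronecker_vec_le (posSemidef_snd_of_mem_dualFeasible hY) hv

theorem dualObjective_mem_upperBounds (hY : Y ∈ dualFeasible Φ) :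
    dualObjective Y ∈ upperBounds {t : ℝ | ∃ X : Matrix (a × a) (a × a) ℂ,
      traceNorm X ≤ 1 ∧ t = traceNorm (tensorId Φ X)} := by
  rintro _ ⟨X, hX, rfl⟩
  calc traceNorm (tensorId Φ X) ≤ traceNorm X * dualObjective Y :=
        traceNorm_tensorId_le_traceNorm_mul (fun _ _ => traceNorm_tensorId_vecMulVec_le hY) X
    _ ≤ dualObjective Y := mul_le_of_le_one_left (dualObjective_nonneg Y) hX

theorem diamondNorm_le_dualObjective (hY : Y ∈ dualFeasible Φ) :
    diamondNorm Φ ≤ dualObjective Y :=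
  Real.sSup_le (dualObjective_mem_upperBounds hY) (dualObjective_nonneg Y)

theorem traceNorm_tensorId_le_diamondNorm {X : Matrix (a × a) (a × a) ℂ} (hX : traceNorm X ≤ 1) :
    traceNorm (tensorId Φ X) ≤ diamondNorm Φ :=
  have ⟨_, hY⟩ := dualFeasible_nonempty Φ
  le_csSup ⟨_, dualObjective_mem_upperBounds hY⟩ ⟨X, hX, rfl⟩

theorem diamondNorm_nonneg (Φ : Matrix a a ℂ →ₗ[ℂ] Matrix b b ℂ) : 0 ≤ diamondNorm Φ :=
  Real.sSup_nonneg (by rintro _ ⟨X, -, rfl⟩; exact Finset.sum_nonneg fun _ _ => Real.sqrt_nonneg _)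

theorem traceNorm_tensorId_le_traceNorm_mul_diamondNorm (Φ : Matrix a a ℂ →ₗ[ℂ] Matrix b b ℂ)
    (X : Matrix (a × a) (a × a) ℂ) :
    traceNorm (tensorId Φ X) ≤ traceNorm X * diamondNorm Φ := by
  refine traceNorm_tensorId_le_traceNorm_mul (fun u v hu hv => ?_) X
  refine traceNorm_tensorId_le_diamondNorm ((traceNorm_vecMulVec_le u v).trans ?_)
  rw [hu, hv]
  norm_num

end WeakDuality

section Minimax

theorem exists_forall_lt_of_forall_exists_lt {E F β : Type*} [LinearOrder β] [DenselyOrdered β]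
    [TopologicalSpace E] [AddCommGroup E] [Module ℝ E] [IsTopologicalAddGroup E]
    [ContinuousSMul ℝ E] [TopologicalSpace F] [AddCommGroup F] [Module ℝ F]
    [IsTopologicalAddGroup F] [ContinuousSMul ℝ F] {X : Set E} {Y : Set F} {f : E → F → β} {t : β}
    (hX : X.Nonempty) (hXc : IsCompact X) (hXv : Convex ℝ X) (hYv : Convex ℝ Y)
    (lsc : ∀ y ∈ Y, LowerSemicontinuousOn (f · y) X) (qconv : ∀ y ∈ Y, QuasiconvexOn ℝ X (f · y))
    (usc : ∀ x ∈ X, UpperSemicontinuousOn (f x) Y) (qconc : ∀ x ∈ X, QuasiconcaveOn ℝ Y (f x))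
    (h : ∀ x ∈ X, ∃ y ∈ Y, t < f x y) : ∃ y ∈ Y, ∀ x ∈ X, t < f x y := by
  choose! g hgY hg using h
  obtain ⟨s, hsX, hs⟩ := hXc.elim_nhdsWithin_subcover (fun x => {x' | t < f x' (g x)})
    fun x hx => lsc _ (hgY x hx) x hx t (hg x hx)
  refine Sion.exists_lt_iInf_of_lt_iInf_of_finite hX hXc lsc qconv hYv usc qconc hXv
    (s.finite_toSet.image g) (Set.image_subset_iff.2 fun x hx => hgY x (hsX x hx)) fun x hx => ?_
  obtain ⟨x', hx', h⟩ := Set.mem_iUnion₂.1 (hs hx)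
  exact ⟨g x', Set.mem_image_of_mem g hx', h⟩

theorem exists_forall_apply_apply_lt_of_forall_exists {E F : Type*}
    [TopologicalSpace E] [AddCommGroup E] [Module ℝ E] [IsTopologicalAddGroup E]
    [ContinuousSMul ℝ E] [TopologicalSpace F] [AddCommGroup F] [Module ℝ F]
    [IsTopologicalAddGroup F] [ContinuousSMul ℝ F] {X : Set E} {Y : Set F} {t : ℝ}
    (hX : X.Nonempty) (hXc : IsCompact X) (hXv : Convex ℝ X) (hYv : Convex ℝ Y)
    (B : E →ₗ[ℝ] F →ₗ[ℝ] ℝ) (hB₁ : ∀ y, Continuous fun x => B x y) (hB₂ : ∀ x, Continuous (B x))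
    (h : ∀ x ∈ X, ∃ y ∈ Y, B x y < t) : ∃ y ∈ Y, ∀ x ∈ X, B x y < t := by
  have ⟨y, hy, hlt⟩ := exists_forall_lt_of_forall_exists_lt (f := fun x y => -B x y) (t := -t)
    hX hXc hXv hYv
    (fun y _ => (hB₁ y).neg.lowerSemicontinuous.lowerSemicontinuousOn X)
    (fun y _ => ((-(B.flip y)).convexOn hXv).quasiconvexOn)
    (fun x _ => (hB₂ x).neg.upperSemicontinuous.upperSemicontinuousOn Y)
    (fun x _ => ((-(B x)).concaveOn hYv).quasiconcaveOn) (by simpa only [neg_lt_neg_iff] using h)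
  exact ⟨y, hy, fun x hx => neg_lt_neg_iff.1 (hlt x hx)⟩

end Minimax

section StrongDuality

theorem exists_isUnit_eq_conjTranspose_mul_self {n : Type*} [Fintype n] [DecidableEq n]
    {σ : Matrix n n ℂ} (hσ : σ.PosDef) : ∃ M : Matrix n n ℂ, IsUnit M ∧ σ = Mᴴ * M := by
  open scoped MatrixOrder Matrix.Norms.L2Operator in
  obtain ⟨M, hM⟩ := CStarAlgebra.nonneg_iff_eq_star_mul_self.1 hσ.posSemidef.nonneg
  exact ⟨M, isUnit_of_mul_isUnit_right (hM ▸ hσ.isUnit), hM⟩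

section

variable {a b : Type*} [DecidableEq a]

theorem smul_add_smul_mem_dualFeasible {Φ Ψ : Matrix a a ℂ →ₗ[ℂ] Matrix b b ℂ}
    {Y Z : Matrix (b × a) (b × a) ℂ × Matrix (b × a) (b × a) ℂ} (hY : Y ∈ dualFeasible Φ)
    (hZ : Z ∈ dualFeasible Ψ) {s t : ℝ} (hs : 0 ≤ s) (ht : 0 ≤ t) :
    s • Y + t • Z ∈ dualFeasible ((s : ℂ) • Φ + (t : ℂ) • Ψ) := by
  have h := (hY.smul hs).add (hZ.smul ht)
  rw [fromBlocks_smul, fromBlocks_smul, fromBlocks_add] at h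
  convert h using 1
  rw [dualFeasible, Set.mem_ofPred_eq]
  congr! 2
  ext i j
  simp [choi]

theorem convex_dualFeasible (Φ : Matrix a a ℂ →ₗ[ℂ] Matrix b b ℂ) :
    Convex ℝ (dualFeasible Φ) := by
  intro Y hY Z hZ s t hs ht hst
  have h := smul_add_smul_mem_dualFeasible hY hZ hs ht
  rwa [← add_smul, ← Complex.ofReal_add, hst, Complex.ofReal_one, one_smul] at h

theorem isClosed_dualFeasible [Finite a] [Finite b] (Φ : Matrix a a ℂ →ₗ[ℂ] Matrix b b ℂ) :
    IsClosed (dualFeasible Φ) :=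
  isClosed_posSemidef.preimage <| continuous_fst.matrix_fromBlocks continuous_const
    continuous_const continuous_snd

end

section

variable {a b : Type*} [Fintype b]

/-- The real bilinear pairing `(σ, Y) ↦ ½ Re tr(tr_B Y₀ σ₀) + ½ Re tr(tr_B Y₁ σ₁)`, whose supremum
over pairs `σ` of density matrices is the dual objective at `Y`. -/
def dualPairing (a b : Type*) [Fintype a] [Fintype b] :
    (Matrix a a ℂ × Matrix a a ℂ) →ₗ[ℝ]
      (Matrix (b × a) (b × a) ℂ × Matrix (b × a) (b × a) ℂ) →ₗ[ℝ] ℝ :=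
  LinearMap.mk₂ ℝ (fun σ Y => 1 / 2 * (partialTraceB Y.1 * σ.1).trace.re +
      1 / 2 * (partialTraceB Y.2 * σ.2).trace.re)
    (fun σ τ Y => by simp [Matrix.mul_add]; ring)
    (fun t σ Y => by simp; ring)
    (fun σ Y Z => by simp [partialTraceB_add, Matrix.add_mul]; ring)
    (fun t σ Y => by simp [partialTraceB_smul]; ring)

variable [Fintype a] [DecidableEq a]

theorem exists_dualPairing_eq_dualObjective [Nonempty a]
    {Φ : Matrix a a ℂ →ₗ[ℂ] Matrix b b ℂ}
    {Y : Matrix (b × a) (b × a) ℂ × Matrix (b × a) (b × a) ℂ} (hY : Y ∈ dualFeasible Φ) :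
    ∃ σ ∈ densityMatrices a ×ˢ densityMatrices a, dualPairing a b σ Y = dualObjective Y := by
  obtain ⟨σ, hσ, hσY⟩ := exists_mem_densityMatrices_re_trace_eq_specNorm
    (posSemidef_partialTraceB (posSemidef_fst_of_mem_dualFeasible hY))
  obtain ⟨τ, hτ, hτY⟩ := exists_mem_densityMatrices_re_trace_eq_specNorm
    (posSemidef_partialTraceB (posSemidef_snd_of_mem_dualFeasible hY))
  refine ⟨(σ, τ), ⟨hσ, hτ⟩, ?_⟩
  rw [dualPairing, LinearMap.mk₂_apply, hσY, hτY, dualObjective]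

variable [DecidableEq b]

theorem one_kronecker_inv_mul_cancel {M N : Matrix a a ℂ} (hM : IsUnit M) (hN : IsUnit N)
    (T : Matrix (b × a) (b × a) ℂ) :
    ((1 : Matrix b b ℂ) ⊗ₖ M⁻¹) * (((1 : Matrix b b ℂ) ⊗ₖ M) * T * ((1 : Matrix b b ℂ) ⊗ₖ N)ᴴ) *
      ((1 : Matrix b b ℂ) ⊗ₖ N⁻¹)ᴴ = T := by
  have inv_mul_cancel {M : Matrix a a ℂ} (hM : IsUnit M) :
      ((1 : Matrix b b ℂ) ⊗ₖ M⁻¹) * ((1 : Matrix b b ℂ) ⊗ₖ M) = 1 := by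
    rw [← mul_kronecker_mul, nonsing_inv_mul _ ((isUnit_iff_isUnit_det _).1 hM), Matrix.mul_one,
      one_kronecker_one]
  rw [Matrix.mul_assoc _ T, ← Matrix.mul_assoc, inv_mul_cancel hM, Matrix.one_mul,
    Matrix.mul_assoc, ← conjTranspose_mul, inv_mul_cancel hN, conjTranspose_one, Matrix.mul_one]

theorem trace_partialTraceB_mul_conjTranspose_mul_self {M : Matrix a a ℂ} (hM : IsUnit M)
    (T : Matrix (b × a) (b × a) ℂ) :
    (partialTraceB (((1 : Matrix b b ℂ) ⊗ₖ M⁻¹) * T * ((1 : Matrix b b ℂ) ⊗ₖ M⁻¹)ᴴ) *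
      (Mᴴ * M)).trace = T.trace := by
  have hM_inv : IsUnit M⁻¹ := (isUnit_nonsing_inv_iff).2 hM
  have h := one_kronecker_inv_mul_cancel hM_inv hM_inv T
  rw [nonsing_inv_nonsing_inv _ ((isUnit_iff_isUnit_det _).1 hM)] at h
  rw [← Matrix.mul_assoc, trace_mul_comm, ← Matrix.mul_assoc,
    ← trace_one_kronecker_mul_mul_conjTranspose, h]

variable (Φ : Matrix a a ℂ →ₗ[ℂ] Matrix b b ℂ)

theorem exists_mem_dualFeasible_dualPairing_le_of_posDef {σ τ : Matrix a a ℂ} (hσ : σ.PosDef)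
    (hτ : τ.PosDef) : ∃ Y ∈ dualFeasible Φ,
      dualPairing a b (σ, τ) Y ≤ (1 / 2 * σ.trace.re + 1 / 2 * τ.trace.re) * diamondNorm Φ := by
  obtain ⟨M, hM, rfl⟩ := exists_isUnit_eq_conjTranspose_mul_self hσ
  obtain ⟨N, hN, rfl⟩ := exists_isUnit_eq_conjTranspose_mul_self hτ
  set X := vecMulVec (vec M) (star (vec N))
  obtain ⟨P, Q, hPQ, hP, hQ⟩ :=
    exists_posSemidef_fromBlocks_trace_eq_traceNorm (tensorId Φ X)
  have hY := posSemidef_fromBlocks_mul hPQ ((1 : Matrix b b ℂ) ⊗ₖ M⁻¹) ((1 : Matrix b b ℂ) ⊗ₖ N⁻¹)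
  rw [tensorId_vecMulVec_vec, one_kronecker_inv_mul_cancel hM hN] at hY
  refine ⟨(_, _), hY, ?_⟩
  calc dualPairing a b (Mᴴ * M, Nᴴ * N) _ = traceNorm (tensorId Φ X) := by
        simp only [dualPairing, LinearMap.mk₂_apply, hP, hQ, Complex.ofReal_re,
          trace_partialTraceB_mul_conjTranspose_mul_self hM,
          trace_partialTraceB_mul_conjTranspose_mul_self hN]
        ring
    _ ≤ traceNorm X * diamondNorm Φ := traceNorm_tensorId_le_traceNorm_mul_diamondNorm Φ X
    _ ≤ _ := by
        have h := traceNorm_vecMulVec_le (vec M) (vec N)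
        rw [star_vec_dotProduct_vec, star_vec_dotProduct_vec] at h
        exact mul_le_mul_of_nonneg_right h (diamondNorm_nonneg Φ)

theorem exists_mem_dualFeasible_dualPairing_lt {σ : Matrix a a ℂ × Matrix a a ℂ}
    (hσ : σ ∈ densityMatrices a ×ˢ densityMatrices a) {t : ℝ} (ht : diamondNorm Φ < t) :
    ∃ Y ∈ dualFeasible Φ, dualPairing a b σ Y < t := by
  obtain ⟨⟨hσ₁, hσ₁_trace⟩, hσ₂, hσ₂_trace⟩ := hσ
  -- A state may be singular, so `σ` is perturbed to the positive definite `σ + δ • 1`.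
  obtain ⟨δ, hδ, hδt⟩ := exists_pos_mul_lt (sub_pos.2 ht) (Fintype.card a * diamondNorm Φ)
  have posDef_one : (δ • (1 : Matrix a a ℂ)).PosDef := PosDef.one.smul hδ
  obtain ⟨Y, hY, hle⟩ := exists_mem_dualFeasible_dualPairing_le_of_posDef Φ
    (PosDef.posSemidef_add hσ₁ posDef_one) (PosDef.posSemidef_add hσ₂ posDef_one)
  have dualPairing_one_nonneg : 0 ≤ dualPairing a b 1 Y := by
    have trace_nonneg {Z : Matrix (b × a) (b × a) ℂ} (hZ : Z.PosSemidef) :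
        0 ≤ (partialTraceB Z * 1).trace.re := by
      rw [Matrix.mul_one]
      exact (Complex.nonneg_iff.1 (posSemidef_partialTraceB hZ).trace_nonneg).1
    have := trace_nonneg (posSemidef_fst_of_mem_dualFeasible hY)
    have := trace_nonneg (posSemidef_snd_of_mem_dualFeasible hY)
    simp only [dualPairing, LinearMap.mk₂_apply, Prod.fst_one, Prod.snd_one]
    positivity
  refine ⟨Y, hY, ?_⟩
  calc dualPairing a b σ Y ≤ dualPairing a b σ Y + δ * dualPairing a b 1 Y :=
        le_add_of_nonneg_right (mul_nonneg hδ.le dualPairing_one_nonneg)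
    _ = dualPairing a b (σ + δ • 1) Y := by simp
    _ ≤ _ := hle
    _ = diamondNorm Φ + Fintype.card a * diamondNorm Φ * δ := by
        simp [hσ₁_trace, hσ₂_trace, trace_add]
        ring
    _ < t := by linarith

theorem exists_mem_dualFeasible_dualObjective_lt {t : ℝ} (ht : diamondNorm Φ < t) :
    ∃ Y ∈ dualFeasible Φ, dualObjective Y < t := by
  rcases isEmpty_or_nonempty a with _ | _
  · obtain ⟨Y, hY⟩ := dualFeasible_nonempty Φ
    refine ⟨Y, hY, lt_of_eq_of_lt ?_ ((diamondNorm_nonneg Φ).trans_lt ht)⟩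
    simp [dualObjective, specNorm, Subsingleton.elim (partialTraceB _) 0]
  · obtain ⟨Y, hY, hlt⟩ := exists_forall_apply_apply_lt_of_forall_exists
      (densityMatrices_nonempty.prod densityMatrices_nonempty)
      (isCompact_densityMatrices.prod isCompact_densityMatrices)
      (convex_densityMatrices.prod convex_densityMatrices) (convex_dualFeasible Φ)
      (dualPairing a b) (fun Y => ((dualPairing a b).flip Y).continuous_of_finiteDimensional)
      (fun σ => (dualPairing a b σ).continuous_of_finiteDimensional)
      fun σ hσ => exists_mem_dualFeasible_dualPairing_lt Φ hσ ht
    obtain ⟨σ, hσ, hσY⟩ := exists_dualPairing_eq_dualObjective hY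
    exact ⟨Y, hY, hσY ▸ hlt σ hσ⟩

end

section

variable {a b : Type*} [Fintype a] [DecidableEq a] [Fintype b]

theorem continuous_dualObjective : Continuous (dualObjective :
    Matrix (b × a) (b × a) ℂ × Matrix (b × a) (b × a) ℂ → ℝ) := by
  have h := continuous_specNorm.comp (continuous_partialTraceB (a := a) (b := b))
  exact (continuous_const.mul (h.comp continuous_fst)).add
    (continuous_const.mul (h.comp continuous_snd))

theorem re_trace_le_specNorm_partialTraceB {Y : Matrix (b × a) (b × a) ℂ} (hY : Y.PosSemidef) :
    Y.trace.re ≤ specNorm (partialTraceB Y) * Fintype.card a := by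
  have h := re_trace_mul_mul_conjTranspose_le (posSemidef_partialTraceB hY) (1 : Matrix a a ℂ)
  simpa [trace_partialTraceB] using h

theorem isCompact_dualFeasible_dualObjective_le (Φ : Matrix a a ℂ →ₗ[ℂ] Matrix b b ℂ) (t : ℝ) :
    IsCompact {Y ∈ dualFeasible Φ | dualObjective Y ≤ t} := by
  have hK := isCompact_posSemidef_trace_le (n := b × a) (2 * t * Fintype.card a)
  refine (hK.prod hK).of_isClosed_subset ((isClosed_dualFeasible Φ).inter
    (isClosed_le continuous_dualObjective continuous_const)) ?_
  rintro Y ⟨hY, ht⟩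
  rw [dualObjective] at ht
  have := specNorm_nonneg (partialTraceB Y.1)
  have := specNorm_nonneg (partialTraceB Y.2)
  have trace_le {Z : Matrix (b × a) (b × a) ℂ} (hZ : Z.PosSemidef)
      (h : specNorm (partialTraceB Z) ≤ 2 * t) : Z.trace.re ≤ 2 * t * Fintype.card a :=
    (re_trace_le_specNorm_partialTraceB hZ).trans (by gcongr)
  have hY₀ := posSemidef_fst_of_mem_dualFeasible hY
  have hY₁ := posSemidef_snd_of_mem_dualFeasible hY
  exact ⟨⟨hY₀, trace_le hY₀ (by linarith)⟩, ⟨hY₁, trace_le hY₁ (by linarith)⟩⟩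

theorem exists_isMinOn_dualObjective (Φ : Matrix a a ℂ →ₗ[ℂ] Matrix b b ℂ) :
    ∃ Y ∈ dualFeasible Φ, IsMinOn dualObjective (dualFeasible Φ) Y := by
  obtain ⟨Y₀, hY₀⟩ := dualFeasible_nonempty Φ
  obtain ⟨Y, ⟨hY, hY_le⟩, hmin⟩ := (isCompact_dualFeasible_dualObjective_le Φ
    (dualObjective Y₀)).exists_isMinOn ⟨Y₀, hY₀, le_rfl⟩ continuous_dualObjective.continuousOn
  exact ⟨Y, hY, fun Z hZ => (le_total (dualObjective Z) (dualObjective Y₀)).elim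
    (fun h => hmin ⟨hZ, h⟩) hY_le.trans⟩

variable [DecidableEq b]

theorem isLeast_dualObjective (Φ : Matrix a a ℂ →ₗ[ℂ] Matrix b b ℂ) :
    IsLeast (dualObjective '' dualFeasible Φ) (diamondNorm Φ) := by
  obtain ⟨Y, hY, hmin⟩ := exists_isMinOn_dualObjective Φ
  refine ⟨⟨Y, hY, (le_of_forall_gt fun t ht => ?_).antisymm (diamondNorm_le_dualObjective hY)⟩,
    Set.forall_mem_image.2 fun Z hZ => diamondNorm_le_dualObjective hZ⟩
  obtain ⟨Z, hZ, hZt⟩ := exists_mem_dualFeasible_dualObjective_lt Φ ht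
  exact (hmin hZ).trans_lt hZt

theorem diamondNorm_smul_add_smul_le (Φ Ψ : Matrix a a ℂ →ₗ[ℂ] Matrix b b ℂ) {s t : ℝ}
    (hs : 0 ≤ s) (ht : 0 ≤ t) : diamondNorm ((s : ℂ) • Φ + (t : ℂ) • Ψ) ≤
      s * diamondNorm Φ + t * diamondNorm Ψ := by
  obtain ⟨Y, hY, hYΦ⟩ := (isLeast_dualObjective Φ).1
  obtain ⟨Z, hZ, hZΨ⟩ := (isLeast_dualObjective Ψ).1
  rw [← hYΦ, ← hZΨ]
  exact (diamondNorm_le_dualObjective (smul_add_smul_mem_dualFeasible hY hZ hs ht)).trans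
    (dualObjective_smul_add_smul_le hs ht Y Z)

end

end StrongDuality

section ApproximateDecomposition

section

variable {ι : Type*} [Fintype ι]

theorem isCompact_budgetFeasible (γ : ℝ) : IsCompact (budgetFeasible ι γ) := by
  refine (isCompact_closedBall (0 : ι → ℝ) |γ|).of_isClosed_subset
    (isClosed_le (by unfold gammaFactor; fun_prop) continuous_const) fun c hc => ?_
  rw [mem_closedBall_zero_iff, pi_norm_le_iff_of_nonneg (abs_nonneg γ)]
  exact fun i => (Finset.single_le_sum (f := fun i => |c i|) (fun _ _ => abs_nonneg _)
    (Finset.mem_univ i)).trans (hc.trans (le_abs_self γ))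

theorem budgetFeasible_nonempty {γ : ℝ} (hγ : 0 ≤ γ) : (budgetFeasible ι γ).Nonempty :=
  ⟨0, by simpa [budgetFeasible, gammaFactor] using hγ⟩

end

variable {a b ι : Type*} [Fintype a] [DecidableEq a] [Fintype b] [DecidableEq b] [Fintype ι]
  (U : Matrix a a ℂ →ₗ[ℂ] Matrix b b ℂ) (E : ι → Matrix a a ℂ →ₗ[ℂ] Matrix b b ℂ)

theorem convexOn_budgetObjective : ConvexOn ℝ Set.univ (budgetObjective U E) := by
  refine ⟨convex_univ, fun c _ d _ s t hs ht hst => ?_⟩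
  have h : U - ∑ i, ((s • c + t • d) i : ℂ) • E i =
      (s : ℂ) • (U - ∑ i, (c i : ℂ) • E i) + (t : ℂ) • (U - ∑ i, (d i : ℂ) • E i) := by
    have hU : U = (s : ℂ) • U + (t : ℂ) • U := by
      rw [← add_smul, ← Complex.ofReal_add, hst, Complex.ofReal_one, one_smul]
    nth_rw 1 [hU]
    simp only [smul_sub, Finset.smul_sum, smul_smul, Pi.add_apply, Pi.smul_apply, smul_eq_mul,
      Complex.ofReal_add, Complex.ofReal_mul, add_smul, Finset.sum_add_distrib]
    abel
  rw [budgetObjective, h]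
  exact diamondNorm_smul_add_smul_le _ _ hs ht

theorem exists_isMinOn_budgetObjective {γ : ℝ} (hγ : 0 ≤ γ) :
    ∃ c ∈ budgetFeasible ι γ, IsMinOn (budgetObjective U E) (budgetFeasible ι γ) c :=
  (isCompact_budgetFeasible γ).exists_isMinOn (budgetFeasible_nonempty hγ)
    (((convexOn_budgetObjective U E).continuousOn isOpen_univ).mono (Set.subset_univ _))

section

variable {a b ι : Type*} [DecidableEq a] [Fintype ι] {U : Matrix a a ℂ →ₗ[ℂ] Matrix b b ℂ}
  {E : ι → Matrix a a ℂ →ₗ[ℂ] Matrix b b ℂ} {γ : ℝ}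

theorem mem_sdpFeasible_iff [Finite a] [Finite b] {z : SDPVar a b ι} : z ∈ sdpFeasible U E γ ↔
    z.1 ∈ budgetFeasible ι γ ∧ z.2 ∈ dualFeasible (U - ∑ i, (z.1 i : ℂ) • E i) := by
  have h_block : ∑ i, (z.1 i : ℂ) • choi (E i) - choi U =
      -choi (U - ∑ i, (z.1 i : ℂ) • E i) := by
    ext i j
    simp [choi, Matrix.sum_apply]
  have h_adjoint : ∑ i, (z.1 i : ℂ) • (choi (E i))ᴴ - (choi U)ᴴ =
      (-choi (U - ∑ i, (z.1 i : ℂ) • E i))ᴴ := by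
    simp [← h_block, conjTranspose_sub, conjTranspose_sum]
  rw [sdpFeasible, Set.mem_ofPred_eq, h_block, h_adjoint, posSemidef_fromBlocks_neg_iff]
  exact ⟨fun ⟨h, hγ, _⟩ => ⟨hγ, h⟩, fun ⟨hγ, h⟩ => ⟨h, hγ,
    posSemidef_fst_of_mem_dualFeasible h, posSemidef_snd_of_mem_dualFeasible h⟩⟩

end

variable {U E} in
theorem isLeast_sdpObjective_of_mem_budgetFeasible {γ : ℝ} {c : ι → ℝ}
    (hc : c ∈ budgetFeasible ι γ) :
    IsLeast (sdpObjective '' {z ∈ sdpFeasible U E γ | z.1 = c}) (budgetObjective U E c) := by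
  have h_image : sdpObjective '' {z ∈ sdpFeasible U E γ | z.1 = c} =
      dualObjective '' dualFeasible (U - ∑ i, (c i : ℂ) • E i) := by
    ext t
    constructor
    · rintro ⟨⟨_, Y⟩, ⟨hz, rfl⟩, rfl⟩
      exact ⟨Y, (mem_sdpFeasible_iff.1 hz).2, rfl⟩
    · rintro ⟨Y, hY, rfl⟩
      exact ⟨(c, Y), ⟨mem_sdpFeasible_iff.2 ⟨hc, hY⟩, rfl⟩, rfl⟩
  exact h_image ▸ isLeast_dualObjective _

end ApproximateDecomposition

section MinimisationInStages

variable {α β R : Type*} [Preorder R] {S : Set α} {T : Set β} {p : β → α} {f : α → R} {g : β → R}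

theorem apply_le_of_isLeast_fiber (hp : Set.MapsTo p T S)
    (h : ∀ x ∈ S, IsLeast (g '' {y ∈ T | p y = x}) (f x)) {y : β} (hy : y ∈ T) :
    f (p y) ≤ g y :=
  (h _ (hp hy)).2 ⟨y, ⟨hy, rfl⟩, rfl⟩

theorem isLeast_image_of_isLeast_fiber (hp : Set.MapsTo p T S)
    (h : ∀ x ∈ S, IsLeast (g '' {y ∈ T | p y = x}) (f x)) {v : R} (hv : IsLeast (f '' S) v) :
    IsLeast (g '' T) v := by
  obtain ⟨⟨x, hx, rfl⟩, hmin⟩ := hv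
  obtain ⟨y, ⟨hy, -⟩, hyx⟩ := (h x hx).1
  exact ⟨⟨y, hy, hyx⟩, Set.forall_mem_image.2 fun z hz =>
    (hmin ⟨_, hp hz, rfl⟩).trans (apply_le_of_isLeast_fiber hp h hz)⟩

theorem isMinOn_iff_of_isLeast_fiber (hp : Set.MapsTo p T S)
    (h : ∀ x ∈ S, IsLeast (g '' {y ∈ T | p y = x}) (f x)) (x : α) :
    (x ∈ S ∧ IsMinOn f S x) ↔ ∃ y ∈ T, IsMinOn g T y ∧ p y = x := by
  constructor
  · rintro ⟨hx, hmin⟩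
    obtain ⟨y, ⟨hy, hyx⟩, hfx⟩ := (h x hx).1
    exact ⟨y, hy, fun z hz =>
      hfx.trans_le ((hmin (hp hz)).trans (apply_le_of_isLeast_fiber hp h hz)), hyx⟩
  · rintro ⟨y, hy, hmin, rfl⟩
    refine ⟨hp hy, fun x hx => ?_⟩
    obtain ⟨z, ⟨hz, -⟩, hfx⟩ := (h x hx).1
    exact (apply_le_of_isLeast_fiber hp h hy).trans ((hmin hz).trans_eq hfx)

end MinimisationInStages

section SemidefiniteRepresentability

theorem posSemidef_fromBlocks_zero_iff {m n : Type*} [Finite m] [Finite n] {P : Matrix m m ℂ}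
    {Q : Matrix n n ℂ} : (fromBlocks P 0 0 Q).PosSemidef ↔ P.PosSemidef ∧ Q.PosSemidef := by
  have := Fintype.ofFinite m
  have := Fintype.ofFinite n
  refine ⟨fun h => ⟨h.submatrix Sum.inl, h.submatrix Sum.inr⟩, fun ⟨hP, hQ⟩ => ?_⟩
  refine .of_dotProduct_mulVec_nonneg
    (hP.isHermitian.fromBlocks conjTranspose_zero hQ.isHermitian) fun x => ?_
  simpa [fromBlocks_mulVec, dotProduct, Fintype.sum_sum_type] using add_nonneg
    (hP.dotProduct_mulVec_nonneg (x ∘ Sum.inl)) (hQ.dotProduct_mulVec_nonneg (x ∘ Sum.inr))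

variable {V W : Type*} [AddCommGroup V] [Module ℝ V] [AddCommGroup W] [Module ℝ W]

theorem semidefiniteRepresentable_of_forall_iff [FiniteDimensional ℝ W] {n : Type*} [Finite n]
    {S : Set V} (C : Matrix n n ℂ) (L : V × W →ₗ[ℝ] Matrix n n ℂ)
    (h : ∀ x, x ∈ S ↔ ∃ w, (C + L (x, w)).PosSemidef) : SemidefiniteRepresentable S := by
  have := Fintype.ofFinite n
  let e := Fintype.equivFin n
  let coord : W ≃ₗ[ℝ] (Fin (Module.finrank ℝ W) → ℝ) := (Module.finBasis ℝ W).equivFun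
  refine ⟨Module.finrank ℝ W, Fintype.card n, reindex e e C,
    (reindexLinearEquiv ℝ ℂ e e).toLinearMap ∘ₗ L ∘ₗ LinearMap.id.prodMap coord.symm.toLinearMap,
    fun x => (h x).trans ?_⟩
  rw [coord.symm.surjective.exists]
  exact exists_congr fun u => (posSemidef_submatrix_equiv e.symm).symm

namespace SemidefiniteRepresentable

theorem inter {S T : Set V} (hS : SemidefiniteRepresentable S) (hT : SemidefiniteRepresentable T) :
    SemidefiniteRepresentable (S ∩ T) := by
  obtain ⟨N, m, C, L, hL⟩ := hS
  obtain ⟨N', m', D, K, hK⟩ := hT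
  let LK : V × (Fin N → ℝ) × (Fin N' → ℝ) →ₗ[ℝ] Matrix (Fin m ⊕ Fin m') (Fin m ⊕ Fin m') ℂ :=
    { toFun := fun x => fromBlocks (L (x.1, x.2.1)) 0 0 (K (x.1, x.2.2))
      map_add' := fun x y => by simp [fromBlocks_add, ← map_add]
      map_smul' := fun t x => by simp [fromBlocks_smul, ← map_smul] }
  refine semidefiniteRepresentable_of_forall_iff (fromBlocks C 0 0 D) LK fun x => ?_
  simp [LK, fromBlocks_add, posSemidef_fromBlocks_zero_iff, hL, hK]

theorem preimage {S : Set W} (hS : SemidefiniteRepresentable S) (f : V →ᵃ[ℝ] W) :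
    SemidefiniteRepresentable (f ⁻¹' S) := by
  obtain ⟨N, m, C, L, hL⟩ := hS
  refine ⟨N, m, C + L (f 0, 0), L ∘ₗ f.linear.prodMap LinearMap.id, fun x => ?_⟩
  have hf : f x = f 0 + f.linear x := by rw [f.decomp, add_comm]; simp
  simp [hL, hf, add_assoc, ← map_add]

theorem image_fst [FiniteDimensional ℝ W] {S : Set (V × W)} (hS : SemidefiniteRepresentable S) :
    SemidefiniteRepresentable (Prod.fst '' S) := by
  obtain ⟨N, m, C, L, hL⟩ := hS
  refine semidefiniteRepresentable_of_forall_iff C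
    (L ∘ₗ (LinearEquiv.prodAssoc ℝ V W (Fin N → ℝ)).symm.toLinearMap) fun x => ?_
  simp only [Set.mem_image, Prod.exists, exists_and_right, exists_eq_right, hL]
  rfl

end SemidefiniteRepresentable

theorem semidefiniteRepresentable_posSemidef {n : Type*} [Finite n] :
    SemidefiniteRepresentable {M : Matrix n n ℂ | M.PosSemidef} :=
  semidefiniteRepresentable_of_forall_iff 0 (LinearMap.fst ℝ (Matrix n n ℂ) PUnit) fun M => by simp

theorem semidefiniteRepresentable_Ici_zero {κ : Type*} [Finite κ] :
    SemidefiniteRepresentable (Set.Ici (0 : κ → ℝ)) := by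
  classical
  let diag : (κ → ℝ) →ₗ[ℝ] Matrix κ κ ℂ :=
    diagonalLinearMap κ ℝ ℂ ∘ₗ Complex.ofRealAm.toLinearMap.compLeft κ
  convert semidefiniteRepresentable_posSemidef.preimage diag.toAffineMap using 1
  ext c
  simp [diag, Pi.le_def]

theorem semidefiniteRepresentable_nonneg (f : V →ᵃ[ℝ] ℝ) :
    SemidefiniteRepresentable {x | 0 ≤ f x} := by
  simpa [Set.preimage, Pi.le_def] using semidefiniteRepresentable_Ici_zero.preimage
    ((LinearMap.pi fun _ : Unit => LinearMap.id).toAffineMap.comp f)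

namespace IsSemidefiniteProgram

variable {S T : Set V} {f g : V → ℝ}

theorem mono (hf : IsSemidefiniteProgram S f) (hT : SemidefiniteRepresentable T) (h : T ⊆ S) :
    IsSemidefiniteProgram T f := by
  rw [IsSemidefiniteProgram]
  convert hf.inter (hT.preimage (LinearMap.fst ℝ V ℝ).toAffineMap) using 1
  ext x
  exact ⟨fun hx => ⟨⟨h hx.1, hx.2⟩, hx.1⟩, fun hx => ⟨hx.2, hx.1.2⟩⟩

theorem comp {S : Set W} {f : W → ℝ} (hf : IsSemidefiniteProgram S f) (p : V →ᵃ[ℝ] W) :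
    IsSemidefiniteProgram (p ⁻¹' S) (f ∘ p) :=
  hf.preimage (p.prodMap (AffineMap.id ℝ ℝ))

theorem mul_add_mul (hf : IsSemidefiniteProgram S f) (hg : IsSemidefiniteProgram T g) {s t : ℝ}
    (hs : 0 ≤ s) (ht : 0 ≤ t) : IsSemidefiniteProgram (S ∩ T) fun x => s * f x + t * g x := by
  let x : (V × ℝ) × ℝ × ℝ →ₗ[ℝ] V := LinearMap.fst ℝ V ℝ ∘ₗ LinearMap.fst ℝ _ _
  let r : (V × ℝ) × ℝ × ℝ →ₗ[ℝ] ℝ := LinearMap.snd ℝ V ℝ ∘ₗ LinearMap.fst ℝ _ _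
  let p : (V × ℝ) × ℝ × ℝ →ₗ[ℝ] ℝ := LinearMap.fst ℝ ℝ ℝ ∘ₗ LinearMap.snd ℝ _ _
  let q : (V × ℝ) × ℝ × ℝ →ₗ[ℝ] ℝ := LinearMap.snd ℝ ℝ ℝ ∘ₗ LinearMap.snd ℝ _ _
  have h := (hf.preimage (x.prod p).toAffineMap).inter ((hg.preimage (x.prod q).toAffineMap).inter
    (semidefiniteRepresentable_nonneg (r - (s • p + t • q)).toAffineMap))
  rw [IsSemidefiniteProgram]
  convert h.image_fst using 1
  ext ⟨y, v⟩
  constructor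
  · rintro ⟨⟨hS, hT⟩, hv⟩
    exact ⟨((y, v), f y, g y), ⟨⟨hS, le_rfl⟩, ⟨hT, le_rfl⟩, sub_nonneg.2 hv⟩, rfl⟩
  · rintro ⟨⟨_, c, d⟩, ⟨⟨hS, hc⟩, ⟨hT, hd⟩, hv⟩, rfl⟩
    exact ⟨⟨hS, hT⟩, (add_le_add (mul_le_mul_of_nonneg_left hc hs)
      (mul_le_mul_of_nonneg_left hd ht)).trans (sub_nonneg.1 hv)⟩

end IsSemidefiniteProgram

theorem isSemidefiniteProgram_specNorm {n : Type*} [Fintype n] [DecidableEq n] :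
    IsSemidefiniteProgram {N : Matrix n n ℂ | N.PosSemidef} specNorm := by
  let N : Matrix n n ℂ × ℝ →ₗ[ℝ] Matrix n n ℂ := LinearMap.fst ℝ _ _
  let s : Matrix n n ℂ × ℝ →ₗ[ℝ] ℝ := LinearMap.snd ℝ _ _
  have h := (semidefiniteRepresentable_posSemidef.preimage N.toAffineMap).inter
    ((semidefiniteRepresentable_nonneg s.toAffineMap).inter
      (semidefiniteRepresentable_posSemidef.preimage (s.smulRight 1 - N).toAffineMap))
  rw [IsSemidefiniteProgram]
  convert h using 1
  ext ⟨M, t⟩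
  constructor
  · rintro ⟨hM, ht⟩
    have t_nonneg := (specNorm_nonneg M).trans ht
    exact ⟨hM, t_nonneg, (specNorm_le_iff hM t_nonneg).1 ht⟩
  · rintro ⟨hM, ht, h⟩
    exact ⟨hM, (specNorm_le_iff hM ht).2 h⟩

theorem semidefiniteRepresentable_budgetFeasible {ι : Type*} [Fintype ι] (γ : ℝ) :
    SemidefiniteRepresentable (budgetFeasible ι γ) := by
  let c : (ι → ℝ) × (ι → ℝ) →ₗ[ℝ] ι → ℝ := LinearMap.fst ℝ _ _
  let u : (ι → ℝ) × (ι → ℝ) →ₗ[ℝ] ι → ℝ := LinearMap.snd ℝ _ _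
  have h := (semidefiniteRepresentable_Ici_zero.preimage (u - c).toAffineMap).inter
    ((semidefiniteRepresentable_Ici_zero.preimage (u + c).toAffineMap).inter
      (semidefiniteRepresentable_nonneg (AffineMap.const ℝ _ γ -
        (Fintype.linearCombination ℝ (fun _ : ι => (1 : ℝ)) ∘ₗ u).toAffineMap)))
  convert h.image_fst using 1
  ext d
  constructor
  · intro hd
    refine ⟨(d, fun i => |d i|), ⟨fun i => sub_nonneg.2 (le_abs_self _),
      fun i => neg_le_iff_add_nonneg.1 (neg_le_abs _), ?_⟩, rfl⟩
    simpa [u, Fintype.linearCombination_apply, budgetFeasible, gammaFactor] using hd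
  · rintro ⟨⟨d, w⟩, ⟨h_sub, h_add, h_sum⟩, rfl⟩
    have abs_le_w (i : ι) : |d i| ≤ w i :=
      abs_le'.2 ⟨sub_nonneg.1 (h_sub i), neg_le_iff_add_nonneg.2 (h_add i)⟩
    refine (Finset.sum_le_sum fun i _ => abs_le_w i).trans ?_
    simpa [u, Fintype.linearCombination_apply] using h_sum

theorem semidefiniteRepresentable_dualFeasible {a b : Type*} [Finite a]
    [DecidableEq a] [Finite b] : SemidefiniteRepresentable
    {x : (Matrix a a ℂ →ₗ[ℂ] Matrix b b ℂ) ×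
      Matrix (b × a) (b × a) ℂ × Matrix (b × a) (b × a) ℂ | x.2 ∈ dualFeasible x.1} := by
  have choi_add (Φ Ψ : Matrix a a ℂ →ₗ[ℂ] Matrix b b ℂ) : choi (Φ + Ψ) = choi Φ + choi Ψ := rfl
  have choi_smul (t : ℝ) (Φ : Matrix a a ℂ →ₗ[ℂ] Matrix b b ℂ) : choi (t • Φ) = t • choi Φ := rfl
  let block : (Matrix a a ℂ →ₗ[ℂ] Matrix b b ℂ) × Matrix (b × a) (b × a) ℂ ×
      Matrix (b × a) (b × a) ℂ →ₗ[ℝ] Matrix ((b × a) ⊕ (b × a)) ((b × a) ⊕ (b × a)) ℂ :=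
    { toFun := fun x => fromBlocks x.2.1 (choi x.1) (choi x.1)ᴴ x.2.2
      map_add' := fun x y => by simp [choi_add, fromBlocks_add]
      map_smul' := fun t x => by simp [choi_smul, fromBlocks_smul] }
  exact semidefiniteRepresentable_posSemidef.preimage block.toAffineMap

variable {a b ι : Type*} [Fintype a] [DecidableEq a] [Fintype b] [Fintype ι]

theorem isSemidefiniteProgram_specNorm_partialTraceB :
    IsSemidefiniteProgram {Y : Matrix (b × a) (b × a) ℂ | Y.PosSemidef}
      fun Y => specNorm (partialTraceB Y) := by
  let trB : Matrix (b × a) (b × a) ℂ →ₗ[ℝ] Matrix a a ℂ :=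
    { toFun := partialTraceB, map_add' := partialTraceB_add, map_smul' := partialTraceB_smul }
  exact (isSemidefiniteProgram_specNorm.comp trB.toAffineMap).mono
    semidefiniteRepresentable_posSemidef fun _ => posSemidef_partialTraceB

theorem isSemidefiniteProgram_dualObjective : IsSemidefiniteProgram
    {x : (Matrix a a ℂ →ₗ[ℂ] Matrix b b ℂ) ×
      Matrix (b × a) (b × a) ℂ × Matrix (b × a) (b × a) ℂ | x.2 ∈ dualFeasible x.1}
    fun x => dualObjective x.2 := by
  let Y := LinearMap.snd ℝ (Matrix a a ℂ →ₗ[ℂ] Matrix b b ℂ)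
    (Matrix (b × a) (b × a) ℂ × Matrix (b × a) (b × a) ℂ)
  have h := (isSemidefiniteProgram_specNorm_partialTraceB.comp
    (LinearMap.fst ℝ _ _ ∘ₗ Y).toAffineMap).mul_add_mul
    (isSemidefiniteProgram_specNorm_partialTraceB.comp
      (LinearMap.snd ℝ _ _ ∘ₗ Y).toAffineMap) one_half_pos.le one_half_pos.le
  exact h.mono semidefiniteRepresentable_dualFeasible fun x hx =>
    ⟨posSemidef_fst_of_mem_dualFeasible hx, posSemidef_snd_of_mem_dualFeasible hx⟩

theorem isSemidefiniteProgram_sdp (U : Matrix a a ℂ →ₗ[ℂ] Matrix b b ℂ)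
    (E : ι → Matrix a a ℂ →ₗ[ℂ] Matrix b b ℂ) (γ : ℝ) :
    IsSemidefiniteProgram (sdpFeasible U E γ) sdpObjective := by
  let c : SDPVar a b ι →ₗ[ℝ] ι → ℝ := LinearMap.fst ℝ _ _
  let Y : SDPVar a b ι →ₗ[ℝ] Matrix (b × a) (b × a) ℂ × Matrix (b × a) (b × a) ℂ :=
    LinearMap.snd ℝ _ _
  let residual : SDPVar a b ι →ᵃ[ℝ] Matrix a a ℂ →ₗ[ℂ] Matrix b b ℂ :=
    AffineMap.const ℝ _ U - (Fintype.linearCombination ℝ E ∘ₗ c).toAffineMap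
  have h := isSemidefiniteProgram_dualObjective.comp (residual.prod Y.toAffineMap)
  have h_feasible : sdpFeasible U E γ = residual.prod Y.toAffineMap ⁻¹' {x | x.2 ∈ dualFeasible x.1}
      ∩ c.toAffineMap ⁻¹' budgetFeasible ι γ := by
    ext z
    exact mem_sdpFeasible_iff.trans and_comm
  rw [h_feasible]
  exact h.mono ((semidefiniteRepresentable_dualFeasible.preimage _).inter
    ((semidefiniteRepresentable_budgetFeasible γ).preimage _)) Set.inter_subset_left

end SemidefiniteRepresentability

end

end ApproxQPD

theorem mainTheorem1 {a b ι : Type*} [Fintype a] [DecidableEq a] [Fintype b] [DecidableEq b]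
    [Fintype ι] (U : Matrix a a ℂ →ₗ[ℂ] Matrix b b ℂ)
    (E : ι → Matrix a a ℂ →ₗ[ℂ] Matrix b b ℂ) (γ : ℝ) :
    -- the program with variables `(a, Y₀, Y₁)` is a semidefinite program
    ApproxQPD.IsSemidefiniteProgram (ApproxQPD.sdpFeasible U E γ)
      (ApproxQPD.sdpObjective (a := a) (b := b) (ι := ι)) ∧
    -- for a nonnegative budget, both minima are attained and they are equal
    (0 ≤ γ → ∃ v : ℝ,
      IsLeast (ApproxQPD.budgetObjective U E '' ApproxQPD.budgetFeasible ι γ) v ∧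
      IsLeast (ApproxQPD.sdpObjective '' ApproxQPD.sdpFeasible U E γ) v) ∧
    -- for fixed coefficients within the budget, minimising over `Y₀, Y₁` gives the diamond norm
    (∀ c ∈ ApproxQPD.budgetFeasible ι γ,
      IsLeast (ApproxQPD.sdpObjective '' {z ∈ ApproxQPD.sdpFeasible U E γ | z.1 = c})
        (ApproxQPD.budgetObjective U E c)) ∧
    -- the optimal coefficients of the two problems are the same
    (∀ c : ι → ℝ,
      (c ∈ ApproxQPD.budgetFeasible ι γ ∧
        IsMinOn (ApproxQPD.budgetObjective U E) (ApproxQPD.budgetFeasible ι γ) c) ↔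
      ∃ z ∈ ApproxQPD.sdpFeasible U E γ,
        IsMinOn ApproxQPD.sdpObjective (ApproxQPD.sdpFeasible U E γ) z ∧ z.1 = c) := by
  have h_fst : Set.MapsTo Prod.fst (ApproxQPD.sdpFeasible U E γ) (ApproxQPD.budgetFeasible ι γ) :=
    fun _ hz => (ApproxQPD.mem_sdpFeasible_iff.1 hz).1
  have h_fiber : ∀ c ∈ ApproxQPD.budgetFeasible ι γ,
      IsLeast (ApproxQPD.sdpObjective '' {z ∈ ApproxQPD.sdpFeasible U E γ | z.1 = c})
        (ApproxQPD.budgetObjective U E c) :=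
    fun _ hc => ApproxQPD.isLeast_sdpObjective_of_mem_budgetFeasible hc
  refine ⟨ApproxQPD.isSemidefiniteProgram_sdp U E γ, fun hγ => ?_, h_fiber,
    ApproxQPD.isMinOn_iff_of_isLeast_fiber h_fst h_fiber⟩
  obtain ⟨c, hc, hmin⟩ := ApproxQPD.exists_isMinOn_budgetObjective U E hγ
  have h_least : IsLeast (ApproxQPD.budgetObjective U E '' ApproxQPD.budgetFeasible ι γ)
      (ApproxQPD.budgetObjective U E c) := ⟨⟨c, hc, rfl⟩, Set.forall_mem_image.2 hmin⟩
  exact ⟨_, h_least, ApproxQPD.isLeast_image_of_isLeast_fiber h_fst h_fiber h_least⟩
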